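/- For an $m\times n$ real matrix $\mathbf P$ put $$\psi^1(\mathbf P)=\inf\Big\{\frac{\|\mathbf a^T\mathbf P\|_1}{\|\mathbf a\|_1}:\ \mathbf a\in\mathbb R^m,\ \mathbf a\ne 0,\ \mathbf a^T\mathbf 1=0\Big\}\qquad(\inf\emptyset=+\infty).$$ An $m\times K$ matrix $\mathbf P$ satisfies $\ell_1$-WStRIP with constants $(\epsilon,\rho,n)$, where $n\le K$, if $\Pr_S\big(\psi^1(\mathbf P_{:,S})\ge\rho\big)\ge 1-\epsilon$, where $S$ is a uniformly random $n$-element subset of $[K]$ and $\mathbf P_{:,S}$ consists of the columns of $\mathbf P$ indexed by $S$. A matrix is $\alpha$-robust simplicial if each of its rows has $\ell_1$-distance at least $\alpha$ from every point of the convex hull of its other rows. Semi-random model with variance $q$. Let $m\ge 1$, let $D\subseteq[K]$ be a fixed set with $|D|\le K/(32m)$, and let $\mathbf W$ be a random $m\times K$ matrix such that: (a) the columns $\mathbf W_{:,j}$, $j\in D$, are deterministic with arbitrary entries in $[0,1]$, and almost surely the maximum entry of every row of $\mathbf W$ is attained in a column of $D$; (b) for $j\notin D$, $W_{ij}=s_j+R_{ij}+\widetilde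 W_{ij}$, where $s_j\in\mathbb R$ is an arbitrary deterministic shift, $\mathbf R$ is deterministic with $\|\mathbf R_{:,j}\|_2\le\frac15$, and the $\widetilde W_{ij}$ ($i\in[m]$, $j\notin D$) are independent, mean zero, of variance $q$, bounded, and sub-gaussian with some parameter $c$, i.e. $\mathbb E\,e^{t\widetilde W_{ij}}\le e^{ct^2}$ for all $t\in\mathbb R$; moreover $0\le W_{ij}\le 1$ almost surely for $j\notin D$. Theorem. For every $q>0$ there are constants $\tilde c,c_1,c_1'>0$, depending only on $q$, such that for all $m,K,m'$ with $m\ge 1$, $2m'\le K$ and $$m'\ \ge\ \frac{512}{21\,\tilde c}\,m\log(eK)$$ and every $\mathbf W$ that follows the semi-random model with variance $q$, the following holds with probability at least $1-\exp(-c_1'\log(eK))$ over $\mathbf W$: the matrix $\mathbf W$ satisfies $\ell_1$-WStRIP with constants $$\Big(2\exp(-c_1\log(eK)),\ \ \rho,\ \ 2m'\Big),\qquad \rho=\frac{13}{60}\,\frac{\sqrt{15m'}}{\sqrt{8m}},$$ and, in particular, for a uniformly random set $S$ of $2m'$ columns the matrix $\mathbf W_{:,S}$ is $\rho$-robust simplicial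 with probability at least $1-2\exp(-c_1\log(eK))$ over $S$. -/

import Mathlib

open MeasureTheory ProbabilityTheory
open scoped Matrix NNReal

noncomputable section

/-- The `ℓ₁`-norm of a real vector. -/
def l1Norm {κ : Type*} [Fintype κ] (v : κ → ℝ) : ℝ := ∑ k, |v k|

/-- `ψ¹(P) = inf { ‖aᵀ P‖₁ / ‖a‖₁ : a ≠ 0, aᵀ 1 = 0 }`. The infimum is taken in the extended
reals, so that it is `+∞` when there is no admissible `a` (a matrix with a single row). -/
def psiOne {ι κ : Type*} [Fintype ι] [Fintype κ] (P : Matrix ι κ ℝ) : EReal :=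
  ⨅ a : {a : ι → ℝ // a ≠ 0 ∧ ∑ i, a i = 0},
    ((l1Norm (a.1 ᵥ* P) / l1Norm a.1 : ℝ) : EReal)

/-- The submatrix of `P` made of the columns in `S`. -/
def columnSubmatrix {ι κ : Type*} (P : Matrix ι κ ℝ) (S : Finset κ) : Matrix ι S ℝ :=
  P.submatrix id (fun j : S => (j : κ))

open scoped Classical in
/-- The probability that a subset of size `n` of `{1, …, K}`, sampled uniformly among all
subsets of size `n`, has the property `p` (used for `n ≤ K`). -/
def uniformSubsetProb (K n : ℕ) (p : Finset (Fin K) → Prop) : ℝ :=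
  (((Finset.powersetCard n (Finset.univ : Finset (Fin K))).filter p).card : ℝ) /
    ((Finset.powersetCard n (Finset.univ : Finset (Fin K))).card : ℝ)

/-- `ℓ₁`-weak statistical RIP with constants `(ε, ρ, n)`: a uniformly random set `S` of `n`
columns satisfies `ψ¹(P_{:,S}) ≥ ρ` with probability at least `1 - ε`. -/
def L1WStRIP {m K : ℕ} (P : Matrix (Fin m) (Fin K) ℝ) (ε ρ : ℝ) (n : ℕ) : Prop :=
  1 - ε ≤ uniformSubsetProb K n (fun S => (ρ : EReal) ≤ psiOne (columnSubmatrix P S))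

/-- `M` is `α`-robust simplicial: every row is at `ℓ₁`-distance at least `α` from each point of
the convex hull of the other rows. -/
def IsRobustSimplicial {ι κ : Type*} [Fintype κ] (α : ℝ) (M : Matrix ι κ ℝ) : Prop :=
  ∀ i : ι, ∀ x ∈ convexHull ℝ ((fun k : ι => M k) '' {k | k ≠ i}), α ≤ l1Norm (M i - x)

/-- The semi-random generative model for an `m × K` matrix `W` (a random variable on `(Ω, μ)`).
`D` is the set of deterministic columns, with values `V`; on the other columns
`W_{ij} = s_j + R_{ij} + N_{ij}` with a deterministic shift `s` that is common to all rows, a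
deterministic perturbation `R`, and random noise `N`, whose entries have variance `q` and
sub-gaussian parameter `c`, i.e. `E exp(t N_{ij}) ≤ exp(c t²)` for all real `t`. -/
structure IsSemiRandom {Ω : Type*} [MeasurableSpace Ω] (μ : Measure Ω) {m K : ℕ} (q : ℝ)
    (c : ℝ≥0) (D : Finset (Fin K)) (V : Matrix (Fin m) (Fin K) ℝ) (s : Fin K → ℝ)
    (R : Matrix (Fin m) (Fin K) ℝ) (N W : Ω → Matrix (Fin m) (Fin K) ℝ) : Prop where
  /-- at most `K / (32 m)` columns are deterministic -/
  card_le : (D.card : ℝ) ≤ (K : ℝ) / (32 * (m : ℝ))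
  /-- the columns in `D` are deterministic -/
  deterministic : ∀ ω, ∀ i, ∀ j ∈ D, W ω i j = V i j
  /-- with arbitrary entries in `[0, 1]` -/
  deterministic_mem : ∀ i, ∀ j ∈ D, V i j ∈ Set.Icc (0 : ℝ) 1
  /-- the maximum of every row is attained in the deterministic part -/
  max_mem : ∀ᵐ ω ∂μ, ∀ i, ∃ j ∈ D, ∀ k, W ω i k ≤ W ω i j
  /-- the columns outside `D` -/
  random : ∀ ω, ∀ i, ∀ j ∉ D, W ω i j = s j + R i j + N ω i j
  /-- the columns of the perturbation have `ℓ₂`-norm at most `1/5` -/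
  perturbation_le : ∀ j ∉ D, Real.sqrt (∑ i, R i j ^ 2) ≤ 1 / 5
  noise_measurable : ∀ i, ∀ j ∉ D, Measurable (fun ω => N ω i j)
  /-- the noise entries are independent -/
  noise_indep : iIndepFun (fun (p : Fin m × {j : Fin K // j ∉ D}) (ω : Ω) => N ω p.1 p.2.1) μ
  noise_mean : ∀ i, ∀ j ∉ D, ∫ ω, N ω i j ∂μ = 0
  noise_variance : ∀ i, ∀ j ∉ D, variance (fun ω => N ω i j) μ = q
  noise_bounded : ∀ i, ∀ j ∉ D, ∃ b : ℝ, ∀ᵐ ω ∂μ, |N ω i j| ≤ b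
  noise_subgaussian : ∀ i, ∀ j ∉ D, HasSubgaussianMGF (fun ω => N ω i j) (2 * c) μ
  /-- the random entries of `W` lie in `[0, 1]` almost surely -/
  random_mem : ∀ᵐ ω ∂μ, ∀ i, ∀ j ∉ D, W ω i j ∈ Set.Icc (0 : ℝ) 1

end

/-! Scale `a` so that its largest entry has modulus 1, at row `i₀`. In a random column `j`, freeze
all entries but `W i₀ j`: the column sum is ±`W i₀ j` plus a constant, hence has second moment at
least `q`. This forces `E exp(-|column sum|) ≤ 1 - δ` with `δ = expGap q`. By independence the
bounds multiply over `T` random columns, and Markov gives an ℓ₁-image above `δT/2` outside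
probability `exp(-δT/2)` (`measureReal_sum_abs_le`).

A union bound over a grid of mesh `1/M`, `M ≈ 4m/δ`, makes this uniform: rounding costs at most `m/M
≤ δ/4` per column, so `δT/4` survives for every `a`, and `‖a‖₁ ≤ m‖a‖_∞` turns it into the constant
`δT/(4m)` (`mul_l1Norm_le_of_grid`). The lower bound on `m'` pays for the grid and makes this
constant at least `ρ` when `T ≥ m'`.

Since `D` is sparse, all but a fraction `8^(-m')` of the sets `S` contain more than `m'` random
columns (`pow_mul_card_powersetCard_inter_le`). Each of these fails with probability at most
`e^(-2L)` over `W`, `L = log(eK)`; Markov applied to the number of failing `S` splits this into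
`e^(-L)` over `W` and `e^(-L)` over `S` (`measureReal_card_filter_le`). -/

/-! ### Exponential moments and the lower tail for a fixed vector -/

theorem exp_neg_le_one_sub_sq {t : ℝ} (h0 : 0 ≤ t) (h3 : t ≤ 3) :
    Real.exp (-t) ≤ 1 - t ^ 2 / 20 := by
  have h1 : 1 + t + t ^ 2 / 2 ≤ Real.exp t := Real.quadratic_le_exp_of_nonneg h0
  have h2 : 0 ≤ 1 - t ^ 2 / 20 := by nlinarith
  have h4 : 1 ≤ (1 - t ^ 2 / 20) * (1 + t + t ^ 2 / 2) := by
    have : 0 ≤ t * (1 + t / 2 - t / 20 * (1 + t + t ^ 2 / 2)) := by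
      refine mul_nonneg h0 ?_
      nlinarith [mul_nonneg h0 h0, mul_nonneg h0 (sub_nonneg.2 h3),
        mul_nonneg (mul_nonneg h0 h0) (sub_nonneg.2 h3)]
    linarith
  rw [Real.exp_neg, inv_le_iff_one_le_mul₀ (Real.exp_pos t)]
  exact h4.trans (mul_le_mul_of_nonneg_left h1 h2)

theorem integrable_exp_neg_abs {Ω : Type*} [MeasurableSpace Ω] (μ : Measure Ω)
    [IsFiniteMeasure μ] {Z : Ω → ℝ} (hZ : Measurable Z) :
    Integrable (fun ω => Real.exp (-|Z ω|)) μ := by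
  refine Integrable.of_bound (C := 1) (by fun_prop) (ae_of_all _ fun ω => ?_)
  rw [Real.norm_of_nonneg (Real.exp_pos _).le]
  exact Real.exp_le_one_iff.2 (by simp)

/-- The exponential moment gap of a `[0, 1]`-valued variable of variance `q`. -/
noncomputable def expGap (q : ℝ) : ℝ := min (q / 20) (1 / 2)

theorem expGap_pos {q : ℝ} (hq : 0 < q) : 0 < expGap q := by
  unfold expGap
  positivity

theorem expGap_le_half (q : ℝ) : expGap q ≤ 1 / 2 := min_le_right _ _

/-- If `|y| ≥ 2`, the argument has modulus at least 1 and `e⁻¹ < 1/2`. Otherwise it has modulus at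
most 3, where `exp(-t) ≤ 1 - t²/20` applies, and its second moment is at least its variance `q`,
whatever `y` is. -/
theorem integral_exp_neg_abs_le {Ω : Type*} [MeasurableSpace Ω] (μ : Measure Ω)
    [IsProbabilityMeasure μ] {X : Ω → ℝ} (hX : Measurable X)
    (h01 : ∀ᵐ ω ∂μ, X ω ∈ Set.Icc (0 : ℝ) 1) {q : ℝ} (hvar : variance X μ = q)
    {b : ℝ} (hb : |b| = 1) (y : ℝ) :
    ∫ ω, Real.exp (-|b * X ω + y|) ∂μ ≤ 1 - expGap q := by
  have hint := integrable_exp_neg_abs μ (Z := fun ω => b * X ω + y) (by fun_prop)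
  have hbX : ∀ᵐ ω ∂μ, |b * X ω| ≤ 1 := by
    filter_upwards [h01] with ω h
    rw [abs_mul, hb, one_mul, abs_of_nonneg h.1]
    exact h.2
  by_cases hy : 2 ≤ |y|
  · have hle : ∫ ω, Real.exp (-|b * X ω + y|) ∂μ ≤ ∫ _, (1 / 2 : ℝ) ∂μ := by
      refine integral_mono_ae hint (integrable_const _) ?_
      filter_upwards [hbX] with ω h
      have h1 : 1 ≤ |b * X ω + y| := by
        have := abs_sub_abs_le_abs_sub y (-(b * X ω))
        rw [abs_neg, sub_neg_eq_add, add_comm y] at this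
        linarith
      refine (Real.exp_le_exp.2 (neg_le_neg h1)).trans ?_
      linarith [Real.exp_neg_one_lt_half]
    simp only [integral_const, probReal_univ, smul_eq_mul, one_mul] at hle
    linarith [expGap_le_half q]
  · push Not at hy
    have hZ : MemLp (fun ω => b * X ω + y) 2 μ := by
      refine MemLp.of_bound (by fun_prop) 3 ?_
      filter_upwards [hbX] with ω h
      rw [Real.norm_eq_abs]
      linarith [abs_add_le (b * X ω) y]
    have hsq : Integrable (fun ω => (b * X ω + y) ^ 2) μ := hZ.integrable_sq
    have hv : q ≤ ∫ ω, (b * X ω + y) ^ 2 ∂μ := by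
      have h1 := variance_le_expectation_sq (μ := μ) (X := fun ω => b * X ω + y) (by fun_prop)
      rw [variance_add_const (by fun_prop), variance_const_mul, hvar, ← sq_abs b, hb] at h1
      simpa using h1
    have hle : ∫ ω, Real.exp (-|b * X ω + y|) ∂μ ≤ ∫ ω, (1 - (b * X ω + y) ^ 2 / 20) ∂μ := by
      refine integral_mono_ae hint ((integrable_const _).sub (hsq.div_const _)) ?_
      filter_upwards [hbX] with ω h
      have h2 := exp_neg_le_one_sub_sq (abs_nonneg (b * X ω + y))
        (by linarith [abs_add_le (b * X ω) y])
      rwa [sq_abs] at h2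
    rw [integral_sub (integrable_const _) (hsq.div_const _), integral_div] at hle
    simp only [integral_const, probReal_univ, smul_eq_mul, one_mul] at hle
    have : expGap q ≤ q / 20 := min_le_left _ _
    linarith

/-- Conditional form of the previous bound: by Fubini, `V` is frozen and `h (V ω)` plays the role of
the constant `y`. -/
theorem integral_mul_exp_neg_abs_le {Ω E : Type*} [MeasurableSpace Ω] [MeasurableSpace E]
    (μ : Measure Ω) [IsProbabilityMeasure μ] {X : Ω → ℝ} {V : Ω → E} (hX : Measurable X)
    (hV : Measurable V) (hind : IndepFun X V μ)
    (h01 : ∀ᵐ ω ∂μ, X ω ∈ Set.Icc (0 : ℝ) 1) {q : ℝ} (hvar : variance X μ = q)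
    {b : ℝ} (hb : |b| = 1) {g h : E → ℝ} (hg : Measurable g) (hh : Measurable h)
    (hg0 : ∀ v, 0 ≤ g v) (hg1 : ∀ v, g v ≤ 1) :
    ∫ ω, g (V ω) * Real.exp (-|b * X ω + h (V ω)|) ∂μ ≤ (1 - expGap q) * ∫ ω, g (V ω) ∂μ := by
  have hmap := (indepFun_iff_map_prod_eq_prod_map_map hX.aemeasurable hV.aemeasurable).1 hind
  have := Measure.isProbabilityMeasure_map (μ := μ) hX.aemeasurable
  have := Measure.isProbabilityMeasure_map (μ := μ) hV.aemeasurable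
  have hm : Measurable fun p : ℝ × E => g p.2 * Real.exp (-|b * p.1 + h p.2|) := by fun_prop
  have hgi : Integrable g (μ.map V) := by
    refine Integrable.of_bound (C := 1) hg.aestronglyMeasurable (ae_of_all _ fun v => ?_)
    rw [Real.norm_of_nonneg (hg0 v)]
    exact hg1 v
  have hi : Integrable (fun p : ℝ × E => g p.2 * Real.exp (-|b * p.1 + h p.2|))
      ((μ.map X).prod (μ.map V)) := by
    refine Integrable.of_bound (C := 1) hm.aestronglyMeasurable (ae_of_all _ fun p => ?_)
    rw [Real.norm_of_nonneg (mul_nonneg (hg0 _) (Real.exp_pos _).le)]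
    exact mul_le_one₀ (hg1 _) (Real.exp_pos _).le (Real.exp_le_one_iff.2 (by simp))
  have h1 : ∫ ω, g (V ω) * Real.exp (-|b * X ω + h (V ω)|) ∂μ
      = ∫ p, g p.2 * Real.exp (-|b * p.1 + h p.2|) ∂(μ.map fun ω => (X ω, V ω)) :=
    (integral_map (hX.prodMk hV).aemeasurable hm.aestronglyMeasurable).symm
  rw [h1, hmap, integral_prod_symm _ hi, ← integral_map hV.aemeasurable hg.aestronglyMeasurable,
    ← integral_const_mul]
  refine integral_mono hi.integral_prod_right (hgi.const_mul _) fun v => ?_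
  simp only
  rw [integral_const_mul, mul_comm, integral_map hX.aemeasurable (by fun_prop)]
  exact mul_le_mul_of_nonneg_right (integral_exp_neg_abs_le μ hX h01 hvar hb _) (hg0 v)

-- Columns are added one at a time. The fresh entry `(i₀, j)` is independent of all the others,
-- which determine both the factor from the earlier columns and the rest of column `j`.
open scoped Classical in
theorem integral_exp_neg_sum_abs_le {Ω ι κ : Type*} [MeasurableSpace Ω] [Fintype ι] [Finite κ]
    (μ : Measure Ω) [IsProbabilityMeasure μ] {X : ι × κ → Ω → ℝ} (hX : ∀ p, Measurable (X p))
    (hind : iIndepFun X μ) (h01 : ∀ p, ∀ᵐ ω ∂μ, X p ω ∈ Set.Icc (0 : ℝ) 1) {q : ℝ}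
    (hvar : ∀ p, variance (X p) μ = q) {b : ι → ℝ} {i₀ : ι} (hb : |b i₀| = 1) (T : Finset κ) :
    ∫ ω, Real.exp (-∑ j ∈ T, |∑ i, b i * X (i, j) ω|) ∂μ ≤ (1 - expGap q) ^ T.card := by
  have := Fintype.ofFinite κ
  induction T using Finset.induction_on with
  | empty => simp
  | insert j T hj ih =>
    set p₀ : ι × κ := (i₀, j) with hp₀
    let U : Finset (ι × κ) := Finset.univ.erase p₀
    have hI := hind.indepFun_finset {p₀} U (by simp [U]) hX
    have hI' : IndepFun (X p₀) (fun ω (p : U) => X p ω) μ :=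
      hI.comp (φ := fun v : (({p₀} : Finset (ι × κ)) → ℝ) => v ⟨p₀, Finset.mem_singleton_self p₀⟩)
        (ψ := id) (measurable_pi_apply _) measurable_id
    -- The default 0 at `p₀` is never read: `j ∉ T`, and row `i₀` is removed from the sum over
    -- column `j`.
    let F : (U → ℝ) → ι × κ → ℝ := fun v p => if hp : p ∈ U then v ⟨p, hp⟩ else 0
    have hF : ∀ p, Measurable fun v => F v p := by
      intro p
      by_cases hp : p ∈ U
      · simp only [F, hp, dite_true]
        fun_prop
      · simp only [F, hp, dite_false]
        fun_prop
    have hFX : ∀ p ≠ p₀, ∀ ω, F (fun p => X p ω) p = X p ω := by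
      intro p hp ω
      simp [F, U, hp]
    have key := integral_mul_exp_neg_abs_le μ (hX p₀) (by fun_prop) hI' (h01 p₀) (hvar p₀) hb
      (g := fun v => Real.exp (-∑ j ∈ T, |∑ i, b i * F v (i, j)|))
      (h := fun v => ∑ i ∈ Finset.univ.erase i₀, b i * F v (i, j))
      (by fun_prop) (by fun_prop) (fun _ => (Real.exp_pos _).le)
      (fun _ => Real.exp_le_one_iff.2 (neg_nonpos.2 (Finset.sum_nonneg fun _ _ => abs_nonneg _)))
    have e1 : ∀ ω, ∑ k ∈ T, |∑ i, b i * F (fun p => X p ω) (i, k)|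
        = ∑ k ∈ T, |∑ i, b i * X (i, k) ω| := by
      intro ω
      refine Finset.sum_congr rfl fun k hk => ?_
      congr 1
      refine Finset.sum_congr rfl fun i _ => ?_
      rw [hFX]
      rintro h
      have hkj : k = j := (Prod.ext_iff.1 h).2
      exact hj (hkj ▸ hk)
    have e2 : ∀ ω, b i₀ * X p₀ ω + ∑ i ∈ Finset.univ.erase i₀, b i * F (fun p => X p ω) (i, j)
        = ∑ i, b i * X (i, j) ω := by
      intro ω
      rw [← Finset.add_sum_erase _ _ (Finset.mem_univ i₀)]
      congr 1
      refine Finset.sum_congr rfl fun i hi => ?_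
      rw [hFX]
      rintro h
      exact Finset.ne_of_mem_erase hi (Prod.ext_iff.1 h).1
    simp only [e1, e2] at key
    have e3 : ∀ ω, Real.exp (-∑ k ∈ insert j T, |∑ i, b i * X (i, k) ω|)
        = Real.exp (-∑ k ∈ T, |∑ i, b i * X (i, k) ω|)
          * Real.exp (-|∑ i, b i * X (i, j) ω|) := by
      intro ω
      rw [← Real.exp_add, Finset.sum_insert hj]
      ring_nf
    simp only [e3]
    rw [Finset.card_insert_of_notMem hj, pow_succ, mul_comm (_ ^ _)]
    exact key.trans (mul_le_mul_of_nonneg_left ih (by linarith [expGap_le_half q]))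

theorem measureReal_sum_abs_le {Ω ι κ : Type*} [MeasurableSpace Ω] [Fintype ι] [Finite κ]
    (μ : Measure Ω) [IsProbabilityMeasure μ] {X : ι × κ → Ω → ℝ} (hX : ∀ p, Measurable (X p))
    (hind : iIndepFun X μ) (h01 : ∀ p, ∀ᵐ ω ∂μ, X p ω ∈ Set.Icc (0 : ℝ) 1) {q : ℝ}
    (hvar : ∀ p, variance (X p) μ = q) {b : ι → ℝ} {i₀ : ι} (hb : |b i₀| = 1) (T : Finset κ) :
    μ.real {ω | ∑ j ∈ T, |∑ i, b i * X (i, j) ω| ≤ expGap q * T.card / 2}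
      ≤ Real.exp (-(expGap q * T.card / 2)) := by
  have hE := integral_exp_neg_sum_abs_le μ hX hind h01 hvar hb T
  have hint : Integrable (fun ω => Real.exp (-∑ j ∈ T, |∑ i, b i * X (i, j) ω|)) μ := by
    refine Integrable.of_bound (C := 1) (by fun_prop) (ae_of_all _ fun ω => ?_)
    rw [Real.norm_of_nonneg (Real.exp_pos _).le]
    exact Real.exp_le_one_iff.2 (neg_nonpos.2 (Finset.sum_nonneg fun _ _ => abs_nonneg _))
  have hM := mul_meas_ge_le_integral_of_nonneg (ae_of_all _ fun ω => (Real.exp_pos _).le) hint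
    (Real.exp (-(expGap q * T.card / 2)))
  simp only [Real.exp_le_exp, neg_le_neg_iff] at hM
  -- Half of the decay `exp(-δT)` pays for Markov's inequality; the other half is the tail bound.
  have hpow : (1 - expGap q) ^ T.card ≤ Real.exp (-(expGap q * T.card / 2)) *
      Real.exp (-(expGap q * T.card / 2)) := by
    rw [← Real.exp_add]
    calc (1 - expGap q) ^ T.card ≤ Real.exp (-expGap q) ^ T.card :=
          pow_le_pow_left₀ (by linarith [expGap_le_half q]) (Real.one_sub_le_exp_neg _) _
      _ = _ := by rw [← Real.exp_nat_mul]; ring_nf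
  exact le_of_mul_le_mul_left (hM.trans (hE.trans hpow)) (Real.exp_pos _)

/-! ### From a finite grid to all vectors -/

theorem mul_l1Norm_le_of_grid {ι κ : Type*} [Fintype ι] (T : Finset κ) {w : ι → κ → ℝ}
    (hw : ∀ i, ∀ j ∈ T, w i j ∈ Set.Icc (0 : ℝ) 1) {M : ℕ} (hM : 0 < M) {θ : ℝ}
    (hθ : T.card * (Fintype.card ι / M : ℝ) ≤ θ)
    (h : ∀ b : ι → ℤ, (∀ i, b i ∈ Finset.Icc (-(M : ℤ)) M) → (∃ i, |b i| = M) →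
      θ < ∑ j ∈ T, |∑ i, ((b i : ℝ) / M) * w i j|) (a : ι → ℝ) :
    (θ - T.card * (Fintype.card ι / M)) * l1Norm a
      ≤ Fintype.card ι * ∑ j ∈ T, |∑ i, a i * w i j| := by
  have hM' : (0 : ℝ) < M := by exact_mod_cast hM
  by_cases ha : ∀ i, a i = 0
  · simp [l1Norm, ha]
  push Not at ha
  obtain ⟨i₁, hi₁⟩ := ha
  have : Nonempty ι := ⟨i₁⟩
  obtain ⟨i₀, hmax⟩ := Finite.exists_max fun i => |a i|
  have hA : 0 < |a i₀| := (abs_pos.2 hi₁).trans_le (hmax i₁)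
  set A := |a i₀| with hAdef
  set b : ι → ℤ := fun i => ⌊a i / A * M⌋ with hbdef
  have habs : ∀ i, |a i / A| ≤ 1 := by
    intro i
    rw [abs_div, abs_of_pos hA, div_le_one hA]
    exact hmax i
  have hbmem : ∀ i, b i ∈ Finset.Icc (-(M : ℤ)) M := by
    intro i
    have h2 := abs_le.1 (habs i)
    rw [Finset.mem_Icc]
    constructor
    · rw [hbdef, Int.le_floor]
      push_cast
      nlinarith
    · have h3 := Int.floor_le (a i / A * M)
      have : ((b i : ℤ) : ℝ) ≤ ((M : ℤ) : ℝ) := by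
        push_cast
        nlinarith
      exact_mod_cast this
  -- Rounding down is exact at `±M`, so the rounded vector keeps a coordinate of modulus exactly 1,
  -- as the tail bound requires.
  have hb₀ : |b i₀| = M := by
    rcases abs_cases (a i₀) with ⟨h1, _⟩ | ⟨h1, _⟩
    · have : a i₀ / A = 1 := by rw [hAdef, h1]; exact div_self (by rw [← h1]; exact hA.ne')
      simp [hbdef, this]
    · have : a i₀ / A = -1 := by
        rw [div_eq_iff hA.ne', hAdef, h1]; ring
      have h5 : b i₀ = -(M : ℤ) := by
        simp only [hbdef, this]
        rw [show (-1 : ℝ) * M = ((-(M : ℤ) : ℤ) : ℝ) by push_cast; ring, Int.floor_intCast]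
      simp [h5]
  have hclose : ∀ i, |a i / A - b i / M| ≤ 1 / M := by
    intro i
    have h1 := Int.floor_le (a i / A * M)
    have h2 := Int.lt_floor_add_one (a i / A * M)
    have h3 : a i / A - b i / M = (a i / A * M - b i) / M := by field_simp
    rw [h3, abs_div, abs_of_pos hM', abs_of_nonneg (by linarith)]
    gcongr
    linarith
  have hcol : ∀ j ∈ T, |∑ i, ((b i : ℝ) / M) * w i j| - Fintype.card ι / M
      ≤ |∑ i, a i / A * w i j| := by
    intro j hj
    have h1 : |∑ i, ((b i : ℝ) / M) * w i j - ∑ i, a i / A * w i j| ≤ Fintype.card ι / M := by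
      rw [← Finset.sum_sub_distrib]
      refine (Finset.abs_sum_le_sum_abs _ _).trans ?_
      calc _ ≤ ∑ _i : ι, (1 / M : ℝ) := by
            refine Finset.sum_le_sum fun i _ => ?_
            rw [← sub_mul, abs_mul, abs_sub_comm, abs_of_nonneg (hw i j hj).1]
            exact (mul_le_of_le_one_right (abs_nonneg _) (hw i j hj).2).trans (hclose i)
        _ = _ := by simp; ring
    linarith [abs_sub_abs_le_abs_sub (∑ i, ((b i : ℝ) / M) * w i j) (∑ i, a i / A * w i j)]
  have hsum := Finset.sum_le_sum hcol
  rw [Finset.sum_sub_distrib, Finset.sum_const, nsmul_eq_mul] at hsum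
  have hscale : A * ∑ j ∈ T, |∑ i, a i / A * w i j| = ∑ j ∈ T, |∑ i, a i * w i j| := by
    rw [Finset.mul_sum]
    refine Finset.sum_congr rfl fun j _ => ?_
    rw [← abs_of_pos hA, ← abs_mul, Finset.mul_sum, abs_of_pos hA]
    congr 1
    refine Finset.sum_congr rfl fun i _ => ?_
    field_simp
  have hl1 : l1Norm a ≤ Fintype.card ι * A := by
    unfold l1Norm
    exact (Finset.sum_le_sum fun i _ => hmax i).trans (by simp)
  have hgrid := h b hbmem ⟨i₀, hb₀⟩
  calc (θ - T.card * (Fintype.card ι / M)) * l1Norm a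
      ≤ (θ - T.card * (Fintype.card ι / M)) * (Fintype.card ι * A) :=
        mul_le_mul_of_nonneg_left hl1 (by linarith)
    _ ≤ (∑ j ∈ T, |∑ i, a i / A * w i j|) * (Fintype.card ι * A) := by
        refine mul_le_mul_of_nonneg_right ?_ (by positivity)
        linarith
    _ = _ := by rw [← hscale]; ring

/-! ### Consequences of the uniform ℓ₁ lower bound -/

theorem le_psiOne {ι κ : Type*} [Fintype ι] [Fintype κ] {P : Matrix ι κ ℝ} {ρ : ℝ}
    (h : ∀ a, ρ * l1Norm a ≤ l1Norm (a ᵥ* P)) : (ρ : EReal) ≤ psiOne P := by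
  refine le_iInf fun a => EReal.coe_le_coe_iff.2 ?_
  have hpos : 0 < l1Norm a.1 := by
    obtain ⟨i, hi⟩ := Function.ne_iff.1 a.2.1
    exact Finset.sum_pos' (fun _ _ => abs_nonneg _) ⟨i, Finset.mem_univ _, abs_pos.2 hi⟩
  rw [le_div_iff₀ hpos]
  exact h a.1

theorem isRobustSimplicial_of_le {ι κ : Type*} [Fintype ι] [Fintype κ]
    {P : Matrix ι κ ℝ} {ρ : ℝ} (hρ : 0 ≤ ρ) (h : ∀ a, ρ * l1Norm a ≤ l1Norm (a ᵥ* P)) :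
    IsRobustSimplicial ρ P := by
  classical
  intro i x hx
  -- Points of the hull are combinations of rows with no weight on row `i`, so `e_i - c` has ℓ₁-norm
  -- at least 1.
  obtain ⟨c, hc0, rfl⟩ : ∃ c : ι → ℝ, c i = 0 ∧ c ᵥ* P = x := by
    have hsub : convexHull ℝ ((fun k : ι => P k) '' {k | k ≠ i})
        ⊆ (LinearMap.range ((Matrix.vecMulLinear P).comp
          (LinearMap.ker (LinearMap.proj (R := ℝ) (φ := fun _ : ι => ℝ) i)).subtype) :
            Set (κ → ℝ)) := by
      refine convexHull_min ?_ (Submodule.convex _)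
      rintro _ ⟨k, hk, rfl⟩
      refine ⟨⟨Pi.single k 1, by simpa using (Pi.single_eq_of_ne (Ne.symm hk) _)⟩, ?_⟩
      ext l
      simp [Matrix.row]
    obtain ⟨c, hc⟩ := hsub hx
    exact ⟨c.1, c.2, hc⟩
  have h1 := h (Pi.single i 1 - c)
  have h2 : (Pi.single i 1 - c) ᵥ* P = P i - c ᵥ* P := by
    rw [Matrix.sub_vecMul]
    ext l
    simp [Matrix.row]
  rw [h2] at h1
  have h3 : 1 ≤ l1Norm (Pi.single i 1 - c) := by
    refine le_trans ?_ (Finset.single_le_sum (fun _ _ => abs_nonneg _) (Finset.mem_univ i))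
    simp [hc0]
  exact (le_mul_of_one_le_right hρ h3).trans h1

/-! ### Averaging over subsets, and counting subsets that meet `D` too often -/

theorem measureReal_card_filter_le {Ω σ : Type*} [MeasurableSpace Ω] (μ : Measure Ω)
    [IsProbabilityMeasure μ] (P : Finset σ) {B : σ → Set Ω} (hB : ∀ s, MeasurableSet (B s))
    {ε : ℝ} (hε : 0 < ε) (h : ∀ s ∈ P, μ.real (B s) ≤ ε * ε) :
    μ.real {ω | ε * P.card < ∑ s ∈ P, (B s).indicator (fun _ => (1 : ℝ)) ω} ≤ ε := by
  rcases P.eq_empty_or_nonempty with rfl | hP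
  · simpa using hε.le
  have hc : (0 : ℝ) < P.card := by exact_mod_cast hP.card_pos
  have hi : ∀ s ∈ P, Integrable ((B s).indicator (fun _ => (1 : ℝ))) μ :=
    fun s _ => (integrable_const _).indicator (hB s)
  have hM := mul_meas_ge_le_integral_of_nonneg (μ := μ)
    (f := fun ω => ∑ s ∈ P, (B s).indicator (fun _ => (1 : ℝ)) ω)
    (ae_of_all _ fun ω => Finset.sum_nonneg fun s _ =>
      Set.indicator_nonneg (fun _ _ => zero_le_one) _)
    (integrable_finsetSum _ hi) (ε * P.card)
  rw [integral_finsetSum _ hi] at hM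
  have hS : ∑ s ∈ P, ∫ ω, (B s).indicator (fun _ => (1 : ℝ)) ω ∂μ ≤ P.card * (ε * ε) := by
    rw [← nsmul_eq_mul]
    refine Finset.sum_le_card_nsmul _ _ _ fun s hs => ?_
    rw [integral_indicator_const _ (hB s)]
    simpa using h s hs
  have hmono : μ.real {ω | ε * P.card < ∑ s ∈ P, (B s).indicator (fun _ => (1 : ℝ)) ω}
      ≤ μ.real {ω | ε * P.card ≤ ∑ s ∈ P, (B s).indicator (fun _ => (1 : ℝ)) ω} :=
    measureReal_mono (fun ω hω => (Set.mem_ofPred_eq ▸ hω : _ < _).le) (measure_ne_top _ _)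
  refine hmono.trans (le_of_mul_le_mul_left (a := ε * P.card) ?_ (by positivity))
  linarith

theorem pow_mul_descFactorial_le {c d K : ℕ} (hc : 1 ≤ c) (h : c * d ≤ K) (k : ℕ) :
    c ^ k * d.descFactorial k ≤ K.descFactorial k := by
  induction k with
  | zero => simp
  | succ k ih =>
    rw [Nat.descFactorial_succ, Nat.descFactorial_succ, pow_succ]
    calc c ^ k * c * ((d - k) * d.descFactorial k)
        = (c * (d - k)) * (c ^ k * d.descFactorial k) := by ring
      _ ≤ (K - k) * K.descFactorial k := by
        refine Nat.mul_le_mul ?_ ih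
        rw [Nat.mul_sub]
        have := Nat.le_mul_of_pos_left k hc
        omega

theorem pow_mul_choose_le {c d K : ℕ} (hc : 1 ≤ c) (h : c * d ≤ K) (k : ℕ) :
    c ^ k * d.choose k ≤ K.choose k := by
  have := pow_mul_descFactorial_le hc h k
  rw [Nat.descFactorial_eq_factorial_mul_choose, Nat.descFactorial_eq_factorial_mul_choose,
    mul_left_comm] at this
  exact Nat.le_of_mul_le_mul_left this (Nat.factorial_pos k)

/-- Union bound: such an `S` is a `k`-subset of `D` together with `n - k` further elements. -/
theorem card_powersetCard_inter_le {K k n : ℕ} (D : Finset (Fin K)) :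
    ((Finset.powersetCard n (Finset.univ : Finset (Fin K))).filter
      (fun S => k ≤ (S ∩ D).card)).card ≤ D.card.choose k * (K - k).choose (n - k) := by
  have hsub : (Finset.powersetCard n (Finset.univ : Finset (Fin K))).filter
      (fun S => k ≤ (S ∩ D).card) ⊆ (Finset.powersetCard k D).biUnion fun T =>
        (Finset.powersetCard (n - k) (Finset.univ \ T)).image (· ∪ T) := by
    intro S hS
    simp only [Finset.mem_filter, Finset.mem_powersetCard, Finset.subset_univ, true_and] at hS
    obtain ⟨T, hT, hTc⟩ := Finset.exists_subset_card_eq hS.2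
    have hTS : T ⊆ S := hT.trans Finset.inter_subset_left
    simp only [Finset.mem_biUnion, Finset.mem_image, Finset.mem_powersetCard]
    refine ⟨T, ⟨hT.trans Finset.inter_subset_right, hTc⟩, S \ T,
      ⟨Finset.sdiff_subset_sdiff (Finset.subset_univ _) le_rfl, ?_⟩,
      Finset.sdiff_union_of_subset hTS⟩
    rw [Finset.card_sdiff_of_subset hTS, hS.1, hTc]
  refine (Finset.card_le_card hsub).trans (Finset.card_biUnion_le.trans ?_)
  rw [← Finset.card_powersetCard k D, ← smul_eq_mul]
  refine Finset.sum_le_card_nsmul _ _ _ fun T hT => Finset.card_image_le.trans ?_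
  rw [Finset.card_powersetCard, Finset.card_sdiff_of_subset (Finset.subset_univ _),
    (Finset.mem_powersetCard.1 hT).2, Finset.card_univ, Fintype.card_fin]

/-- The density of `D` gives `32^k`; choosing which half of `S` lies in `D` costs `C(2k, k) ≤ 4^k`.
-/
theorem pow_mul_card_powersetCard_inter_le {K k : ℕ} (D : Finset (Fin K)) (h : 32 * D.card ≤ K) :
    8 ^ k * ((Finset.powersetCard (2 * k) (Finset.univ : Finset (Fin K))).filter
      (fun S => k ≤ (S ∩ D).card)).card
      ≤ (Finset.powersetCard (2 * k) (Finset.univ : Finset (Fin K))).card := by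
  have h1 := card_powersetCard_inter_le (k := k) (n := 2 * k) D
  have h2 := pow_mul_choose_le (by norm_num) h k
  have h3 : K.choose (2 * k) * (2 * k).choose k = K.choose k * (K - k).choose (2 * k - k) :=
    Nat.choose_mul (by omega)
  have h4 : (2 * k).choose k ≤ 4 ^ k := by
    have := Nat.choose_le_two_pow (2 * k) k
    rwa [pow_mul] at this
  rw [Finset.card_powersetCard, Finset.card_univ, Fintype.card_fin]
  refine le_of_mul_le_mul_left (a := 4 ^ k) ?_ (by positivity)
  calc _ ≤ 4 ^ k * (8 ^ k * (D.card.choose k * (K - k).choose (2 * k - k))) := by gcongr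
    _ = 32 ^ k * D.card.choose k * (K - k).choose (2 * k - k) := by
      rw [show (32 : ℕ) = 4 * 8 by norm_num, mul_pow]; ring
    _ ≤ K.choose k * (K - k).choose (2 * k - k) := by gcongr
    _ = K.choose (2 * k) * (2 * k).choose k := h3.symm
    _ ≤ K.choose (2 * k) * 4 ^ k := by gcongr
    _ = _ := mul_comm _ _

theorem one_sub_le_uniformSubsetProb {K n : ℕ} (hn : n ≤ K) {p : Finset (Fin K) → Prop} {ε : ℝ}
    (A B : Finset (Finset (Fin K)))
    (h : ∀ S ∈ Finset.powersetCard n Finset.univ, S ∉ A → S ∉ B → p S)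
    (hA : (A.card : ℝ) ≤ ε * (Finset.powersetCard n (Finset.univ : Finset (Fin K))).card)
    (hB : (B.card : ℝ) ≤ ε * (Finset.powersetCard n (Finset.univ : Finset (Fin K))).card) :
    1 - 2 * ε ≤ uniformSubsetProb K n p := by
  classical
  unfold uniformSubsetProb
  set P := Finset.powersetCard n (Finset.univ : Finset (Fin K)) with hP
  have hc : (0 : ℝ) < P.card := by
    rw [hP, Finset.card_powersetCard, Finset.card_univ, Fintype.card_fin]
    exact_mod_cast Nat.choose_pos hn
  rw [le_div_iff₀ hc]
  have hsub : P ⊆ P.filter p ∪ (A ∪ B) := by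
    intro S hS
    by_cases h1 : S ∈ A
    · simp [h1]
    by_cases h2 : S ∈ B
    · simp [h2]
    exact Finset.mem_union_left _ (Finset.mem_filter.2 ⟨hS, h S hS h1 h2⟩)
  have h3 : P.card ≤ (P.filter p).card + (A.card + B.card) :=
    (Finset.card_le_card hsub).trans ((Finset.card_union_le _ _).trans
      (Nat.add_le_add_left (Finset.card_union_le _ _) _))
  have h4 : (P.card : ℝ) ≤ (P.filter p).card + (A.card + B.card) := by exact_mod_cast h3
  convert (by linarith : (1 - 2 * ε) * (P.card : ℝ) ≤ (P.filter p).card)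

/-! ### Numerical constants -/

/-- The grid has at most `exp(12mL/δ) ≤ exp(δm'/4)` points, so half of the exponent `δm'/2` remains,
which is at least `12mL/δ ≥ 24L`. -/
theorem grid_mul_exp_le {δ L : ℝ} {m K m' M : ℕ} (hδ : 0 < δ) (hδ' : δ ≤ 1 / 2) (hm : 0 < m)
    (hmK : m ≤ K) (hL : L = 1 + Real.log K) (hM : (M : ℝ) ≤ 4 * m / δ + 1)
    (h : 48 / δ ^ 2 * m * L ≤ m') :
    ((2 * M + 1 : ℕ) : ℝ) ^ m * Real.exp (-(δ * m' / 2)) ≤ Real.exp (-L) * Real.exp (-L) := by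
  have hm1 : (1 : ℝ) ≤ m := by exact_mod_cast hm
  have hmK' : (m : ℝ) ≤ K := by exact_mod_cast hmK
  have hL1 : 1 ≤ L := by linarith [Real.log_nonneg (hm1.trans hmK')]
  have hbase : ((2 * M + 1 : ℕ) : ℝ) ≤ Real.exp (12 / δ * L) := by
    have h1 : ((2 * M + 1 : ℕ) : ℝ) ≤ 11 / δ * m := by
      push_cast
      have : 3 ≤ 3 * m / δ := by
        rw [le_div_iff₀ hδ]
        nlinarith
      calc (2 * M + 1 : ℝ) ≤ 8 * m / δ + 3 := by
            have : 8 * m / δ = 2 * (4 * m / δ) := by ring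
            linarith
        _ ≤ 8 * m / δ + 3 * m / δ := by linarith
        _ = _ := by ring
    have h2 : 11 / δ ≤ Real.exp (11 / δ) := by linarith [Real.add_one_le_exp (11 / δ)]
    have h3 : (m : ℝ) ≤ Real.exp (Real.log K) := by
      rw [Real.exp_log (by linarith)]
      exact hmK'
    calc ((2 * M + 1 : ℕ) : ℝ) ≤ 11 / δ * m := h1
      _ ≤ Real.exp (11 / δ) * Real.exp (Real.log K) := by gcongr
      _ = Real.exp (11 / δ + Real.log K) := (Real.exp_add _ _).symm
      _ ≤ Real.exp (12 / δ * L) := by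
        refine Real.exp_le_exp.2 ?_
        have h4 : 1 ≤ 1 / δ := by
          rw [le_div_iff₀ hδ]
          linarith
        have h5 : 11 / δ = 11 * (1 / δ) := by ring
        have h6 : 12 / δ = 12 * (1 / δ) := by ring
        rw [h5, h6]
        nlinarith [mul_nonneg (sub_nonneg.2 h4) (sub_nonneg.2 hL1)]
  have h48 : 48 / δ * m * L ≤ δ * m' := by
    have := mul_le_mul_of_nonneg_left h hδ.le
    refine le_trans (le_of_eq ?_) this
    field_simp
  have h96 : (96 : ℝ) ≤ 48 / δ := by
    rw [le_div_iff₀ hδ]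
    linarith
  have hmL : L ≤ m * L := le_mul_of_one_le_left (by linarith) hm1
  calc _ ≤ Real.exp (12 / δ * L) ^ m * Real.exp (-(δ * m' / 2)) := by gcongr
    _ = Real.exp (12 / δ * m * L - δ * m' / 2) := by
      rw [← Real.exp_nat_mul, ← Real.exp_add]
      ring_nf
    _ ≤ Real.exp (-L + -L) := by
      refine Real.exp_le_exp.2 ?_
      have h7 : 12 / δ * m * L = (48 / δ * m * L) / 4 := by ring
      have h8 : 96 * (m * L) ≤ 48 / δ * m * L := by
        rw [mul_assoc (48 / δ)]
        exact mul_le_mul_of_nonneg_right h96 (by linarith)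
      linarith
    _ = _ := Real.exp_add _ _

/-- One bound grows like `√(m'/m)`, the other like `δm'/m`, so the latter wins once `m'/m` is of
order `1/δ²`. -/
theorem sqrt_ratio_le {δ : ℝ} {m m' : ℕ} (hδ : 0 < δ) (hm : 0 < m)
    (h : 48 / δ ^ 2 * m ≤ m') :
    13 / 60 * (Real.sqrt (15 * (m' : ℝ)) / Real.sqrt (8 * (m : ℝ))) ≤ δ * m' / (4 * m) := by
  have hm0 : (0 : ℝ) < m := by exact_mod_cast hm
  have hm' : (0 : ℝ) ≤ m' := Nat.cast_nonneg _
  rw [← Real.sqrt_div (by positivity)]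
  have h1 : 15 * (m' : ℝ) / (8 * m) ≤ (δ * m' / (4 * m)) ^ 2 := by
    rw [div_pow, div_le_div_iff₀ (by positivity) (by positivity)]
    have h2 : 48 * (m : ℝ) ≤ δ ^ 2 * m' := by
      have := mul_le_mul_of_nonneg_left h (sq_nonneg δ)
      refine le_trans (le_of_eq ?_) this
      field_simp
    nlinarith [mul_le_mul_of_nonneg_left h2 (mul_nonneg hm0.le hm'),
      mul_nonneg (mul_nonneg hm0.le hm0.le) hm']
  have h3 := Real.sqrt_le_sqrt h1
  rw [Real.sqrt_sq (by positivity)] at h3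
  have h4 := Real.sqrt_nonneg (15 * (m' : ℝ) / (8 * m))
  linarith

/-! ### The grid event in the semi-random model -/

/-- The random columns of `S`. -/
def randomColumns {K : ℕ} (D S : Finset (Fin K)) : Finset {j : Fin K // j ∉ D} :=
  S.subtype (· ∉ D)

theorem card_randomColumns {K : ℕ} (D S : Finset (Fin K)) :
    (randomColumns D S).card + (S ∩ D).card = S.card := by
  rw [randomColumns, Finset.card_subtype, ← Finset.filter_mem_eq_inter, add_comm]
  exact Finset.card_filter_add_card_filter_not _

theorem sum_randomColumns_le {m K : ℕ} (D S : Finset (Fin K)) (P : Matrix (Fin m) (Fin K) ℝ)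
    (a : Fin m → ℝ) :
    ∑ j ∈ randomColumns D S, |∑ i, a i * P i j| ≤ l1Norm (a ᵥ* columnSubmatrix P S) := by
  have h1 : l1Norm (a ᵥ* columnSubmatrix P S) = ∑ j ∈ S, |∑ i, a i * P i j| :=
    Finset.sum_coe_sort S fun j => |∑ i, a i * P i j|
  rw [h1, randomColumns, Finset.sum_subtype_eq_sum_filter (f := fun j => |∑ i, a i * P i j|)]
  exact Finset.sum_le_sum_of_subset_of_nonneg (Finset.filter_subset _ _)
    fun _ _ _ => abs_nonneg _

namespace IsSemiRandom

variable {Ω : Type*} [MeasurableSpace Ω] {μ : Measure Ω} {m K : ℕ} {q : ℝ} {c : ℝ≥0}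
  {D : Finset (Fin K)} {V : Matrix (Fin m) (Fin K) ℝ} {s : Fin K → ℝ}
  {R : Matrix (Fin m) (Fin K) ℝ} {N W : Ω → Matrix (Fin m) (Fin K) ℝ}

theorem entry_eq (h : IsSemiRandom μ q c D V s R N W) (p : Fin m × {j : Fin K // j ∉ D}) :
    (fun ω => W ω p.1 p.2) = fun ω => s p.2 + R p.1 p.2 + N ω p.1 p.2 :=
  funext fun ω => h.random ω p.1 p.2 p.2.2

theorem measurable_entry (h : IsSemiRandom μ q c D V s R N W)
    (p : Fin m × {j : Fin K // j ∉ D}) : Measurable fun ω => W ω p.1 p.2 := by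
  rw [h.entry_eq]
  exact (h.noise_measurable p.1 p.2 p.2.2).const_add _

theorem iIndepFun_entry (h : IsSemiRandom μ q c D V s R N W) :
    iIndepFun (fun (p : Fin m × {j : Fin K // j ∉ D}) ω => W ω p.1 p.2) μ := by
  rw [show (fun (p : Fin m × {j : Fin K // j ∉ D}) ω => W ω p.1 p.2) = _ from funext h.entry_eq]
  exact h.noise_indep.comp (fun p x => s p.2 + R p.1 p.2 + x) fun p => measurable_const_add _

theorem variance_entry [IsProbabilityMeasure μ] (h : IsSemiRandom μ q c D V s R N W)
    (p : Fin m × {j : Fin K // j ∉ D}) : variance (fun ω => W ω p.1 p.2) μ = q := by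
  rw [h.entry_eq, variance_const_add (h.noise_measurable p.1 p.2 p.2.2).aestronglyMeasurable]
  exact h.noise_variance p.1 p.2 p.2.2

end IsSemiRandom

/-- Integer vectors with entries in `[-M, M]`, one of which is `± M`. -/
noncomputable def integerGrid (m M : ℕ) : Finset (Fin m → ℤ) :=
  (Fintype.piFinset fun _ => Finset.Icc (-(M : ℤ)) M).filter fun b => ∃ i, |b i| = M

theorem card_integerGrid_le (m M : ℕ) : (integerGrid m M).card ≤ (2 * M + 1) ^ m := by
  refine (Finset.card_filter_le _ _).trans (le_of_eq ?_)
  rw [Fintype.card_piFinset_const, Int.card_Icc]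
  congr 1
  omega

/-- The event that some grid vector has a small `ℓ₁`-image on the random columns of `S`. -/
def gridFailure {Ω : Type*} {m K : ℕ} (D : Finset (Fin K)) (W : Ω → Matrix (Fin m) (Fin K) ℝ)
    (δ : ℝ) (M : ℕ) (S : Finset (Fin K)) : Set Ω :=
  ⋃ b ∈ integerGrid m M, {ω | ∑ j ∈ randomColumns D S, |∑ i, ((b i : ℝ) / M) * W ω i j|
    ≤ δ * (randomColumns D S).card / 2}

theorem measurableSet_gridFailure {Ω : Type*} [MeasurableSpace Ω] {m K : ℕ} {D : Finset (Fin K)}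
    {W : Ω → Matrix (Fin m) (Fin K) ℝ}
    (hW : ∀ p : Fin m × {j : Fin K // j ∉ D}, Measurable fun ω => W ω p.1 p.2) (δ : ℝ) (M : ℕ)
    (S : Finset (Fin K)) : MeasurableSet (gridFailure D W δ M S) := by
  refine Finset.measurableSet_biUnion _ fun b _ => measurableSet_le ?_ measurable_const
  refine Finset.measurable_sum _ fun j _ => Measurable.abs ?_
  exact Finset.measurable_sum _ fun i _ => (hW (i, j)).const_mul _

theorem IsSemiRandom.measureReal_gridFailure_le {Ω : Type*} [MeasurableSpace Ω] {μ : Measure Ω}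
    [IsProbabilityMeasure μ] {m K : ℕ} {q : ℝ} {c : ℝ≥0}
    {D : Finset (Fin K)} {V : Matrix (Fin m) (Fin K) ℝ} {s : Fin K → ℝ}
    {R : Matrix (Fin m) (Fin K) ℝ} {N W : Ω → Matrix (Fin m) (Fin K) ℝ}
    (h : IsSemiRandom μ q c D V s R N W) {M : ℕ} (hM : 0 < M) (S : Finset (Fin K)) :
    μ.real (gridFailure D W (expGap q) M S)
      ≤ ((2 * M + 1 : ℕ) : ℝ) ^ m * Real.exp (-(expGap q * (randomColumns D S).card / 2)) := by
  refine (measureReal_biUnion_finset_le _ _).trans ?_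
  refine (Finset.sum_le_card_nsmul _ _
    (Real.exp (-(expGap q * (randomColumns D S).card / 2))) fun b hb => ?_).trans ?_
  · obtain ⟨i₀, hi₀⟩ := (Finset.mem_filter.1 hb).2
    refine measureReal_sum_abs_le μ
      (X := fun (p : Fin m × {j : Fin K // j ∉ D}) ω => W ω p.1 p.2)
      h.measurable_entry h.iIndepFun_entry ?_ h.variance_entry (b := fun i => (b i : ℝ) / M) (i₀ := i₀) ?_ _
    · intro p
      filter_upwards [h.random_mem] with ω hω using hω p.1 p.2 p.2.2
    · have h1 : |(b i₀ : ℝ)| = M := by exact_mod_cast hi₀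
      rw [abs_div, h1, Nat.abs_cast, div_self]
      exact_mod_cast hM.ne'
  · rw [nsmul_eq_mul]
    gcongr
    exact_mod_cast card_integerGrid_le m M

theorem mul_l1Norm_le_of_notMem_gridFailure {Ω : Type*} {m K m' M : ℕ} {D S : Finset (Fin K)}
    {W : Ω → Matrix (Fin m) (Fin K) ℝ} {δ : ℝ} {ω : Ω} (hδ : 0 < δ) (hm : 0 < m)
    (hM : 4 * m / δ ≤ M) (hW : ∀ i, ∀ j ∉ D, W ω i j ∈ Set.Icc (0 : ℝ) 1)
    (hS : m' ≤ (randomColumns D S).card) (hω : ω ∉ gridFailure D W δ M S) (a : Fin m → ℝ) :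
    δ * m' / (4 * m) * l1Norm a ≤ l1Norm (a ᵥ* columnSubmatrix (W ω) S) := by
  have hm0 : (0 : ℝ) < m := by exact_mod_cast hm
  have hM0 : (0 : ℝ) < M := lt_of_lt_of_le (by positivity) hM
  set T := randomColumns D S with hT
  have hTm : (m' : ℝ) ≤ T.card := by exact_mod_cast hS
  have hmM : (m : ℝ) / M ≤ δ / 4 := by
    rw [div_le_iff₀ hδ] at hM
    rw [div_le_div_iff₀ hM0 (by norm_num)]
    linarith
  have hTM : T.card * ((m : ℝ) / M) ≤ T.card * (δ / 4) := by gcongr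
  have hTδ : 0 ≤ T.card * (δ / 4) := by positivity
  have hgrid := mul_l1Norm_le_of_grid T (w := fun i j => W ω i j)
    (fun i j _ => hW i j j.2) (M := M) (by exact_mod_cast hM0) (θ := δ * T.card / 2)
    (by rw [Fintype.card_fin]; linarith) (fun b hb hbM => by
      by_contra hle
      refine hω (Set.mem_biUnion (Finset.mem_coe.2 (Finset.mem_filter.2 ⟨?_, hbM⟩)) (not_lt.1 hle))
      exact Fintype.mem_piFinset.2 hb) a
  rw [Fintype.card_fin] at hgrid
  have hl : 0 ≤ l1Norm a := Finset.sum_nonneg fun _ _ => abs_nonneg _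
  have h1 : δ * m' / 4 * l1Norm a ≤ (δ * T.card / 2 - T.card * (m / M)) * l1Norm a := by
    refine mul_le_mul_of_nonneg_right ?_ hl
    have := mul_le_mul_of_nonneg_left hTm hδ.le
    linarith
  have h2 : δ * m' / (4 * m) * l1Norm a = (δ * m' / 4 * l1Norm a) / m := by field_simp
  rw [h2, div_le_iff₀ hm0, mul_comm _ (m : ℝ)]
  exact (h1.trans hgrid).trans
    (mul_le_mul_of_nonneg_left (sum_randomColumns_le D S (W ω) a) hm0.le)

theorem card_powersetCard_inter_le_exp {K k : ℕ} (D : Finset (Fin K)) (h : 32 * D.card ≤ K)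
    {L : ℝ} (hL : L ≤ k) :
    (((Finset.powersetCard (2 * k) (Finset.univ : Finset (Fin K))).filter
      (fun S => k ≤ (S ∩ D).card)).card : ℝ)
      ≤ Real.exp (-L) * (Finset.powersetCard (2 * k) (Finset.univ : Finset (Fin K))).card := by
  have h1 := pow_mul_card_powersetCard_inter_le (k := k) D h
  have h2 : Real.exp L ≤ 8 ^ k := by
    calc Real.exp L ≤ Real.exp (k * 1) := Real.exp_le_exp.2 (by linarith)
      _ = Real.exp 1 ^ k := Real.exp_nat_mul _ _
      _ ≤ 8 ^ k := pow_le_pow_left₀ (Real.exp_pos _).le (by linarith [Real.exp_one_lt_d9]) _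
  have h3 : (8 : ℝ) ^ k * ((Finset.powersetCard (2 * k) (Finset.univ : Finset (Fin K))).filter
      (fun S => k ≤ (S ∩ D).card)).card
      ≤ (Finset.powersetCard (2 * k) (Finset.univ : Finset (Fin K))).card := by exact_mod_cast h1
  rw [Real.exp_neg, inv_mul_eq_div, le_div_iff₀ (Real.exp_pos _), mul_comm]
  exact (mul_le_mul_of_nonneg_right h2 (Nat.cast_nonneg _)).trans h3

/-! ### The main theorem -/

theorem theorem2 (q : ℝ) (hq : 0 < q) :
    ∃ ctilde c₁ c₁' : ℝ, 0 < ctilde ∧ 0 < c₁ ∧ 0 < c₁' ∧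
      ∀ (Ω : Type*) [MeasurableSpace Ω] (μ : Measure Ω) [IsProbabilityMeasure μ]
        (m K m' : ℕ) (c : ℝ≥0) (D : Finset (Fin K)) (V : Matrix (Fin m) (Fin K) ℝ)
        (s : Fin K → ℝ) (R : Matrix (Fin m) (Fin K) ℝ) (N W : Ω → Matrix (Fin m) (Fin K) ℝ),
        0 < m →
        2 * m' ≤ K →
        512 / (21 * ctilde) * (m : ℝ) * Real.log (Real.exp 1 * (K : ℝ)) ≤ (m' : ℝ) →
        IsSemiRandom μ q c D V s R N W →
        1 - Real.exp (-c₁' * Real.log (Real.exp 1 * (K : ℝ))) ≤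
          μ.real {ω |
            L1WStRIP (W ω) (2 * Real.exp (-c₁ * Real.log (Real.exp 1 * (K : ℝ))))
                (13 / 60 * (Real.sqrt (15 * (m' : ℝ)) / Real.sqrt (8 * (m : ℝ)))) (2 * m') ∧
              1 - 2 * Real.exp (-c₁ * Real.log (Real.exp 1 * (K : ℝ))) ≤
                uniformSubsetProb K (2 * m') (fun S =>
                  IsRobustSimplicial
                    (13 / 60 * (Real.sqrt (15 * (m' : ℝ)) / Real.sqrt (8 * (m : ℝ))))
                    (columnSubmatrix (W ω) S))} := by
  classical
  have hδ := expGap_pos hq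
  have hδ' := expGap_le_half q
  set δ := expGap q with hδdef
  -- Chosen so that `512 / (21 * ctilde) = 48 / δ ^ 2`.
  refine ⟨512 * δ ^ 2 / (21 * 48), 1, 1, by positivity, one_pos, one_pos, ?_⟩
  intro Ω _ μ _ m K m' c D V s R N W hm hK hm' h
  rw [show 512 / (21 * (512 * δ ^ 2 / (21 * 48))) = 48 / δ ^ 2 by field_simp] at hm'
  simp only [neg_one_mul]
  rcases Nat.eq_zero_or_pos K with hK0 | hK0
  -- Here `Real.log 0 = 0`, so the claimed lower bound on the probability is 0.
  · simp [hK0]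
  have hm1 : (1 : ℝ) ≤ m := by exact_mod_cast hm
  have hK1 : (1 : ℝ) ≤ K := by exact_mod_cast hK0
  have hL : Real.log (Real.exp 1 * (K : ℝ)) = 1 + Real.log K := by
    rw [Real.log_mul (Real.exp_pos _).ne' (by positivity), Real.log_exp]
  set L := Real.log (Real.exp 1 * (K : ℝ)) with hLdef
  have hL1 : 1 ≤ L := by linarith [Real.log_nonneg hK1]
  have h48 : 1 ≤ 48 / δ ^ 2 := by
    rw [le_div_iff₀ (by positivity)]
    nlinarith
  have hmL : m * L ≤ m' := by
    refine le_trans ?_ hm'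
    rw [mul_assoc]
    exact le_mul_of_one_le_left (by positivity) h48
  have hmm' : (m : ℝ) ≤ m' := (le_mul_of_one_le_right (by positivity) hL1).trans hmL
  have hLm' : L ≤ m' := (le_mul_of_one_le_left (by positivity) hm1).trans hmL
  have hmK : m ≤ K := by
    have : m ≤ m' := by exact_mod_cast hmm'
    omega
  have hD : 32 * D.card ≤ K := by
    have h1 := h.card_le
    rw [le_div_iff₀ (by positivity)] at h1
    have h2 : (32 : ℝ) * D.card ≤ K := by
      refine le_trans ?_ h1
      nlinarith [mul_nonneg (Nat.cast_nonneg (α := ℝ) D.card) (sub_nonneg.2 hm1)]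
    exact_mod_cast h2
  have hρ := sqrt_ratio_le hδ hm
    (le_trans (le_mul_of_one_le_right (by positivity) hL1) hm')
  have hρ0 : 0 ≤ 13 / 60 * (Real.sqrt (15 * (m' : ℝ)) / Real.sqrt (8 * (m : ℝ))) := by positivity
  set ρ := 13 / 60 * (Real.sqrt (15 * (m' : ℝ)) / Real.sqrt (8 * (m : ℝ))) with hρdef
  set M := ⌈4 * m / δ⌉₊ with hMdef
  have hM1 : 4 * m / δ ≤ M := Nat.le_ceil _
  have hM2 : (M : ℝ) ≤ 4 * m / δ + 1 := (Nat.ceil_lt_add_one (by positivity)).le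
  have hM0 : 0 < M := Nat.ceil_pos.2 (by positivity)
  set P := Finset.powersetCard (2 * m') (Finset.univ : Finset (Fin K)) with hP
  set A := P.filter fun S => m' ≤ (S ∩ D).card with hA
  set Q := P.filter fun S => ¬ m' ≤ (S ∩ D).card with hQ
  have hcols : ∀ S ∈ P, S ∉ A → m' ≤ (randomColumns D S).card := by
    intro S hS hSA
    have h1 := card_randomColumns D S
    have h2 := (Finset.mem_powersetCard.1 hS).2
    have h3 : ¬ m' ≤ (S ∩ D).card := fun h' => hSA (Finset.mem_filter.2 ⟨hS, h'⟩)
    omega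
  have hfail : ∀ S ∈ Q, μ.real (gridFailure D W δ M S) ≤ Real.exp (-L) * Real.exp (-L) := by
    intro S hS
    obtain ⟨hS, hSA⟩ := Finset.mem_filter.1 hS
    have hc : (m' : ℝ) ≤ (randomColumns D S).card := by
      exact_mod_cast hcols S hS fun h' => hSA (Finset.mem_filter.1 h').2
    refine (h.measureReal_gridFailure_le hM0 S).trans
      (le_trans ?_ (grid_mul_exp_le hδ hδ' hm hmK hL hM2 hm'))
    gcongr
  have hmarkov := measureReal_card_filter_le μ Q
    (fun S => measurableSet_gridFailure h.measurable_entry δ M S) (Real.exp_pos (-L)) hfail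
  set E := {ω | Real.exp (-L) * Q.card
    < ∑ S ∈ Q, (gridFailure D W δ M S).indicator (fun _ => (1 : ℝ)) ω} with hE
  set Z := {ω | ¬ ∀ i, ∀ j ∉ D, W ω i j ∈ Set.Icc (0 : ℝ) 1} with hZ
  have hZ0 : μ.real Z = 0 := by
    rw [measureReal_def, ae_iff.1 h.random_mem, ENNReal.toReal_zero]
  set G := {ω | L1WStRIP (W ω) (2 * Real.exp (-L)) ρ (2 * m') ∧
    1 - 2 * Real.exp (-L) ≤ uniformSubsetProb K (2 * m') (fun S =>
      IsRobustSimplicial ρ (columnSubmatrix (W ω) S))} with hG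
  -- Covering by `G`, `E`, `Z` needs only subadditivity, so measurability of `G` is never required.
  have hcover : (Set.univ : Set Ω) ⊆ G ∪ (E ∪ Z) := by
    intro ω _
    by_cases hωE : ω ∈ E
    · exact Or.inr (Or.inl hωE)
    by_cases hωZ : ω ∈ Z
    · exact Or.inr (Or.inr hωZ)
    refine Or.inl ?_
    simp only [hZ, Set.mem_ofPred_eq, not_not] at hωZ
    set B := Q.filter fun S => ω ∈ gridFailure D W δ M S with hB
    have hAc : (A.card : ℝ) ≤ Real.exp (-L) * P.card := card_powersetCard_inter_le_exp D hD hLm'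
    have hBc : (B.card : ℝ) ≤ Real.exp (-L) * P.card := by
      have h1 : (B.card : ℝ)
          = ∑ S ∈ Q, (gridFailure D W δ M S).indicator (fun _ => (1 : ℝ)) ω := by
        simp only [hB, Finset.card_filter, Set.indicator_apply]
        push_cast
        rfl
      rw [h1]
      refine (not_lt.1 hωE).trans ?_
      gcongr
      exact Finset.filter_subset _ _
    have hgood : ∀ S ∈ P, S ∉ A → S ∉ B →
        ∀ a, ρ * l1Norm a ≤ l1Norm (a ᵥ* columnSubmatrix (W ω) S) := by
      intro S hS hSA hSB a
      have hω : ω ∉ gridFailure D W δ M S := fun h' =>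
        hSB (Finset.mem_filter.2 ⟨Finset.mem_filter.2
          ⟨hS, fun h'' => hSA (Finset.mem_filter.2 ⟨hS, h''⟩)⟩, h'⟩)
      exact (mul_le_mul_of_nonneg_right hρ (Finset.sum_nonneg fun _ _ => abs_nonneg _)).trans
        (mul_l1Norm_le_of_notMem_gridFailure hδ hm hM1 hωZ (hcols S hS hSA) hω a)
    exact ⟨one_sub_le_uniformSubsetProb hK A B
        (fun S hS hSA hSB => le_psiOne (hgood S hS hSA hSB)) hAc hBc,
      one_sub_le_uniformSubsetProb hK A B
        (fun S hS hSA hSB => isRobustSimplicial_of_le hρ0 (hgood S hS hSA hSB)) hAc hBc⟩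
  have h1 : (1 : ℝ) ≤ μ.real G + (μ.real E + μ.real Z) := by
    calc (1 : ℝ) = μ.real Set.univ := by simp
      _ ≤ μ.real (G ∪ (E ∪ Z)) := measureReal_mono hcover (measure_ne_top _ _)
      _ ≤ μ.real G + μ.real (E ∪ Z) := measureReal_union_le _ _
      _ ≤ _ := by gcongr; exact measureReal_union_le _ _
  linarith
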